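/- **Formulas.** Fix a countably infinite set of atomic propositions $x_0,x_1,x_2,\dots$ The set $\mathsf{ML}$ of modal formulas is generated from the atomic propositions by $\neg$, $\to$ and $\Box$. The set $\mathsf{MTL}$ of modal team logic formulas is the closure of $\mathsf{ML}$ under strong negation ${\sim}$, material implication $\rightarrowtriangle$, linear implication $\multimap$, and the unary modalities $\Box$ and $\Delta$ (there is only one symbol $\Box$; thus, for $\alpha\in\mathsf{ML}$, the word $\Box\alpha$ is an $\mathsf{ML}$ formula). Abbreviate $\alpha\lor\beta:=\neg\alpha\to\beta$, $\ \bot:=\neg(x_0\to x_0)$, $\ \mathrm{NE}:={\sim}\bot$, $\ \varphi\curlyvee\psi:={\sim}\varphi\rightarrowtriangle\psi$, $\ \varphi\curlywedge\psi:={\sim}(\varphi\rightarrowtriangle{\sim}\psi)$, $\ \varphi\leftrightarrowtriangle\psi:=(\varphi\rightarrowtriangle\psi)\curlywedge(\psi\rightarrowtriangle\varphi)$, $\ \varphi\otimes\psi:={\sim}(\varphi\multimap{\sim}\psi)$, $\ \Diamond\varphi:={\sim}\Delta{\sim}\varphi$. For a set $\mathcal L$ of formulas, $\mathcal S^+(\mathcal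 L)$ is the closure of $\mathcal L$ under $\curlywedge$, $\curlyvee$ and $\otimes$ only. **The proof system $\mathsf{H}^\Box\mathsf{L}\mathsf{S}\mathsf{M}$.** Here $\alpha,\beta,\gamma$ range over $\mathsf{ML}$ and $\varphi,\psi,\vartheta$ over $\mathsf{MTL}$; all implications associate to the right. The axioms are all instances of the following schemes. - $\mathsf{H}^\Box$: $\ \alpha\to(\beta\to\alpha)$; $\ (\alpha\to(\beta\to\gamma))\to(\alpha\to\beta)\to(\alpha\to\gamma)$; $\ (\neg\alpha\to\neg\beta)\to(\beta\to\alpha)$; $\ \Box(\alpha\to\beta)\to(\Box\alpha\to\Box\beta)$. - $\mathsf{L}$: $\ \varphi\rightarrowtriangle(\psi\rightarrowtriangle\varphi)$; $\ (\varphi\rightarrowtriangle(\psi\rightarrowtriangle\vartheta))\rightarrowtriangle(\varphi\rightarrowtriangle\psi)\rightarrowtriangle(\varphi\rightarrowtriangle\vartheta)$; $\ ({\sim}\varphi\rightarrowtriangle{\sim}\psi)\rightarrowtriangle(\psi\rightarrowtriangle\varphi)$; $\ (\alpha\to\beta)\rightarrowtriangle(\alpha\rightarrowtriangle\beta)$.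 - $\mathsf{S}$: $\ (\alpha\otimes\beta)\leftrightarrowtriangle(\alpha\lor\beta)$; $\ \alpha\rightarrowtriangle(\varphi\multimap\alpha)$; $\ \varphi\rightarrowtriangle(\varphi\multimap\psi)\rightarrowtriangle(\vartheta\multimap\psi)$; $\ (\varphi\multimap\psi\multimap\vartheta)\rightarrowtriangle(\psi\multimap\varphi\multimap\vartheta)$; $\ (\varphi\multimap{\sim}\psi)\rightarrowtriangle(\psi\multimap{\sim}\varphi)$; $\ (\varphi\multimap(\psi\rightarrowtriangle\vartheta))\rightarrowtriangle(\varphi\multimap\psi)\rightarrowtriangle(\varphi\multimap\vartheta)$. - $\mathsf{M}$: $\ \Box{\sim}\varphi\leftrightarrowtriangle{\sim}\Box\varphi$; $\ \Diamond\alpha\leftrightarrowtriangle\neg\Box\neg\alpha$; $\ \Diamond(\varphi\otimes\psi)\leftrightarrowtriangle\Diamond\varphi\otimes\Diamond\psi$; $\ \Box\alpha\rightarrowtriangle\Delta\alpha$; $\ \Diamond\varphi\rightarrowtriangle(\Delta\psi\rightarrowtriangle\Box\psi)$; $\ \Box(\varphi\rightarrowtriangle\psi)\rightarrowtriangle(\Box\varphi\rightarrowtriangle\Box\psi)$;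 $\ \Delta(\varphi\rightarrowtriangle\psi)\rightarrowtriangle(\Delta\varphi\rightarrowtriangle\Delta\psi)$. The inference rules are: from $\alpha$ and $\alpha\to\beta$ infer $\beta$; from $\varphi$ and $\varphi\rightarrowtriangle\psi$ infer $\psi$; and, if $\varphi$ is a theorem (that is, derived from no premises), infer $\Box\varphi$, $\Delta\varphi$ and $\psi\multimap\varphi$ (in particular $\Box\alpha$ for a theorem $\alpha\in\mathsf{ML}$). For a set $\Phi\subseteq\mathsf{MTL}$ of premises, write $\Phi\vdash\varphi$ if $\varphi$ is derivable from $\Phi$ in this system. **Theorem.** For every $\varphi\in\mathsf{MTL}$ there is a formula $\psi\in\mathcal S^+(\mathsf{ML}\cup\{\mathrm{NE}\})$ that is provably equivalent to $\varphi$ in $\mathsf{H}^\Box\mathsf{L}\mathsf{S}\mathsf{M}$, i.e. $\{\varphi\}\vdash\psi$ and $\{\psi\}\vdash\varphi$. -/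

import Mathlib

namespace TeamLogic

/-- Words over the symbols of modal team logic. The atomic propositions are indexed by `ℕ`.
`neg`, `imp` are the classical connectives `¬`, `→`; `snot`, `mimp` are the strong negation `∼` and
the material implication `⇾` of team logic; `limp` is the linear implication `⊸`.
There is one symbol `□`, used both by classical modal logic and by modal team logic. -/
inductive Formula : Type
  | atom (n : ℕ) : Formula
  | neg (a : Formula) : Formula
  | imp (a b : Formula) : Formula
  | snot (a : Formula) : Formula
  | mimp (a b : Formula) : Formula
  | limp (a b : Formula) : Formula
  | box (a : Formula) : Formula
  | delta (a : Formula) : Formula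

namespace Formula

/-- Classical disjunction `α ∨ β`. -/
def or (a b : Formula) : Formula := imp (neg a) b

/-- Classical `⊤`, that is `x₀ → x₀`. -/
def top : Formula := imp (atom 0) (atom 0)

/-- Classical `⊥`, that is `¬⊤`. -/
def bot : Formula := neg top

/-- The non-emptiness atom `NE`, that is `∼⊥`. -/
def NE : Formula := snot bot

/-- Team-logical (Boolean) disjunction. -/
def sor (a b : Formula) : Formula := mimp (snot a) b

/-- Team-logical (Boolean) conjunction. -/
def sand (a b : Formula) : Formula := snot (mimp a (snot b))

/-- Team-logical (Boolean) equivalence. -/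
def siff (a b : Formula) : Formula := sand (mimp a b) (mimp b a)

/-- The splitting operator `a ⊗ b`, that is `∼(a ⊸ ∼b)`. -/
def tensor (a b : Formula) : Formula := snot (limp a (snot b))

/-- The team modality `◇`, that is `∼Δ∼`. -/
def dia (a : Formula) : Formula := snot (delta (snot a))

end Formula

open Formula

/-- Formulas of classical modal logic. -/
inductive IsML : Formula → Prop
  | atom (n : ℕ) : IsML (atom n)
  | neg {a : Formula} : IsML a → IsML (neg a)
  | imp {a b : Formula} : IsML a → IsML b → IsML (imp a b)
  | box {a : Formula} : IsML a → IsML (box a)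

/-- The set `ML` of formulas of classical modal logic. -/
def ML : Set Formula := {a | IsML a}

/-- The closure of `L` under `∼`, `⇾`, `⊸`, `□` and `Δ`. -/
inductive InModalClosure (L : Set Formula) : Formula → Prop
  | base {a : Formula} : a ∈ L → InModalClosure L a
  | snot {a : Formula} : InModalClosure L a → InModalClosure L (snot a)
  | mimp {a b : Formula} : InModalClosure L a → InModalClosure L b → InModalClosure L (mimp a b)
  | limp {a b : Formula} : InModalClosure L a → InModalClosure L b → InModalClosure L (limp a b)
  | box {a : Formula} : InModalClosure L a → InModalClosure L (box a)
  | delta {a : Formula} : InModalClosure L a → InModalClosure L (delta a)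

/-- The set `MTL` of formulas of modal team logic. -/
def MTL : Set Formula := {a | InModalClosure ML a}

/-- The closure of `L` under Boolean conjunction, Boolean disjunction and `⊗` only. -/
inductive InSPlus (L : Set Formula) : Formula → Prop
  | base {a : Formula} : a ∈ L → InSPlus L a
  | sand {a b : Formula} : InSPlus L a → InSPlus L b → InSPlus L (sand a b)
  | sor {a b : Formula} : InSPlus L a → InSPlus L b → InSPlus L (sor a b)
  | tensor {a b : Formula} : InSPlus L a → InSPlus L b → InSPlus L (tensor a b)

/-- The set `S⁺(L)`. -/
def SPlus (L : Set Formula) : Set Formula := {a | InSPlus L a}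

/-- The axioms of the system `H□`; they are instantiated with classical formulas only. -/
inductive AxH : Formula → Prop
  | A1 {a b : Formula} : a ∈ ML → b ∈ ML → AxH (imp a (imp b a))
  | A2 {a b c : Formula} : a ∈ ML → b ∈ ML → c ∈ ML →
      AxH (imp (imp a (imp b c)) (imp (imp a b) (imp a c)))
  | A3 {a b : Formula} : a ∈ ML → b ∈ ML → AxH (imp (imp (neg a) (neg b)) (imp b a))
  | K {a b : Formula} : a ∈ ML → b ∈ ML → AxH (imp (box (imp a b)) (imp (box a) (box b)))

/-- The axioms of the system `L` (lifted propositional axioms). -/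
inductive AxL : Formula → Prop
  | L1 {f g : Formula} : f ∈ MTL → g ∈ MTL → AxL (mimp f (mimp g f))
  | L2 {f g h : Formula} : f ∈ MTL → g ∈ MTL → h ∈ MTL →
      AxL (mimp (mimp f (mimp g h)) (mimp (mimp f g) (mimp f h)))
  | L3 {f g : Formula} : f ∈ MTL → g ∈ MTL → AxL (mimp (mimp (snot f) (snot g)) (mimp g f))
  | L4 {a b : Formula} : a ∈ ML → b ∈ ML → AxL (mimp (imp a b) (mimp a b))

/-- The axioms of the system `S` (splitting). -/
inductive AxS : Formula → Prop
  | FTensor {a b : Formula} : a ∈ ML → b ∈ ML → AxS (siff (tensor a b) (or a b))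
  | FLimp {a f : Formula} : a ∈ ML → f ∈ MTL → AxS (mimp a (limp f a))
  | Lax {f g h : Formula} : f ∈ MTL → g ∈ MTL → h ∈ MTL →
      AxS (mimp f (mimp (limp f g) (limp h g)))
  | Ex {f g h : Formula} : f ∈ MTL → g ∈ MTL → h ∈ MTL →
      AxS (mimp (limp f (limp g h)) (limp g (limp f h)))
  | C {f g : Formula} : f ∈ MTL → g ∈ MTL → AxS (mimp (limp f (snot g)) (limp g (snot f)))
  | Dis {f g h : Formula} : f ∈ MTL → g ∈ MTL → h ∈ MTL →
      AxS (mimp (limp f (mimp g h)) (mimp (limp f g) (limp f h)))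

/-- The axioms of the system `M` (modalities). -/
inductive AxM : Formula → Prop
  | LinBox {f : Formula} : f ∈ MTL → AxM (siff (box (snot f)) (snot (box f)))
  | FDia {a : Formula} : a ∈ ML → AxM (siff (dia a) (neg (box (neg a))))
  | DDiaTensor {f g : Formula} : f ∈ MTL → g ∈ MTL →
      AxM (siff (dia (tensor f g)) (tensor (dia f) (dia g)))
  | EBox {a : Formula} : a ∈ ML → AxM (mimp (box a) (delta a))
  | IBox {f g : Formula} : f ∈ MTL → g ∈ MTL → AxM (mimp (dia f) (mimp (delta g) (box g)))
  | DisBox {f g : Formula} : f ∈ MTL → g ∈ MTL →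
      AxM (mimp (box (mimp f g)) (mimp (box f) (box g)))
  | DisDelta {f g : Formula} : f ∈ MTL → g ∈ MTL →
      AxM (mimp (delta (mimp f g)) (mimp (delta f) (delta g)))

/-- `Derives Φ φ`: the formula `φ` is derivable from the set of premises `Φ ⊆ MTL` in the proof
system `H□LSM`, the union of `H□`, `L`, `S` and `M`. The necessitation rules apply to theorems
only, that is, to formulas derived from the empty set of premises. -/
inductive Derives : Set Formula → Formula → Prop
  | premise {Φ : Set Formula} {f : Formula} : f ∈ Φ → Derives Φ f
  | axH {Φ : Set Formula} {f : Formula} : AxH f → Derives Φ f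
  | axL {Φ : Set Formula} {f : Formula} : AxL f → Derives Φ f
  | axS {Φ : Set Formula} {f : Formula} : AxS f → Derives Φ f
  | axM {Φ : Set Formula} {f : Formula} : AxM f → Derives Φ f
  | mpImp {Φ : Set Formula} {a b : Formula} : a ∈ ML → b ∈ ML →
      Derives Φ a → Derives Φ (imp a b) → Derives Φ b
  | necML {Φ : Set Formula} {a : Formula} : a ∈ ML → Derives ∅ a → Derives Φ (box a)
  | mpMimp {Φ : Set Formula} {f g : Formula} : f ∈ MTL → g ∈ MTL →
      Derives Φ f → Derives Φ (mimp f g) → Derives Φ g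
  | necLimp {Φ : Set Formula} {f g : Formula} : f ∈ MTL → g ∈ MTL →
      Derives ∅ f → Derives Φ (limp g f)
  | necBox {Φ : Set Formula} {f : Formula} : f ∈ MTL → Derives ∅ f → Derives Φ (box f)
  | necDelta {Φ : Set Formula} {f : Formula} : f ∈ MTL → Derives ∅ f → Derives Φ (delta f)

/-- Provable equivalence `φ ⊣⊢ ψ` in `H□LSM`. -/
def ProvEquiv (f g : Formula) : Prop := Derives {f} g ∧ Derives {g} f

end TeamLogic

/-! Call a formula normal if, up to provable equivalence, it is a finite join of terms α ⋏ ∼β₁ ⋏ … ⋏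
∼βₙ with α and all βᵢ classical. Classical formulas are normal, and normality survives every
connective. For the Boolean ones this is distributivity and De Morgan; □ commutes with them. The
duals ⊗ and ◇ of ⊸ and Δ preserve joins, so for them only terms matter.

The key is that in a team satisfying α, ∼β says that some nonempty subteam satisfies α ∧ ¬β. Since
splittings may overlap, this witness can be added back to one part of a splitting. Hence ∼β can be
pulled out of ⊗ and ◇, becoming another negated classical formula (`IsTerm.tensor_cut`,
`IsTerm.dia_cut`). What remains is classical, where ⊗ is ∨ and ◇ is ¬□¬. Finally ∼α equals ⊤ ⊗ (NE ⋏
¬α) by `tensor_witness`, so normal forms lie in S⁺(ML ∪ {NE}).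

The argument runs in Lindenbaum algebras: the axioms become the equations and inequalities of a
`TeamAlgebra`, and the rest is Boolean algebra. -/

namespace TeamLogic

/-! ### Propositional Hilbert systems and their Lindenbaum algebras -/

/-- A Hilbert system for classical propositional logic, based on implication and negation. -/
structure HilbertSystem (F : Type) where
  imp : F → F → F
  neg : F → F
  base : F
  Thm : F → Prop
  mp {p q : F} : Thm p → Thm (imp p q) → Thm q
  ax1 (p q : F) : Thm (imp p (imp q p))
  ax2 (p q r : F) : Thm (imp (imp p (imp q r)) (imp (imp p q) (imp p r)))
  ax3 (p q : F) : Thm (imp (imp (neg p) (neg q)) (imp q p))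

namespace HilbertSystem

variable {F : Type} (H : HilbertSystem F)

/-- Derivability from a set of premises by modus ponens. -/
inductive Prf (Γ : Set F) : F → Prop
  | hyp {p : F} : p ∈ Γ → Prf Γ p
  | thm {p : F} : H.Thm p → Prf Γ p
  | mp {p q : F} : Prf Γ p → Prf Γ (H.imp p q) → Prf Γ q

variable {H} {Γ : Set F} {p q r : F}

theorem Prf.toThm (h : H.Prf ∅ p) : H.Thm p := by
  induction h with
  | hyp h => exact h.elim
  | thm h => exact h
  | mp _ _ h₁ h₂ => exact H.mp h₁ h₂

theorem Prf.weaken {Δ : Set F} (hΓ : Γ ⊆ Δ) (h : H.Prf Γ p) : H.Prf Δ p := by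
  induction h with
  | hyp h => exact .hyp (hΓ h)
  | thm h => exact .thm h
  | mp _ _ h₁ h₂ => exact .mp h₁ h₂

theorem Prf.imp_of (h : H.Prf Γ q) : H.Prf Γ (H.imp p q) := .mp h (.thm (H.ax1 q p))

theorem thm_imp_self (p : F) : H.Thm (H.imp p p) :=
  H.mp (H.ax1 p p) (H.mp (H.ax1 p (H.imp p p)) (H.ax2 p (H.imp p p) p))

/-- The deduction theorem survives necessitation rules because theorems enter `Prf` only as leaves;
modus ponens is the sole rule that acts under premises. -/
theorem Prf.intro (h : H.Prf (insert p Γ) q) : H.Prf Γ (H.imp p q) := by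
  induction h with
  | hyp h =>
    rcases h with rfl | h
    · exact .thm (thm_imp_self _)
    · exact (Prf.hyp h).imp_of
  | thm h => exact (Prf.thm h).imp_of
  | mp _ _ h₁ h₂ => exact .mp h₁ (.mp h₂ (.thm (H.ax2 _ _ _)))

theorem Prf.exfalso (h : H.Prf Γ p) (h' : H.Prf Γ (H.neg p)) (q : F) : H.Prf Γ q :=
  .mp h (.mp h'.imp_of (.thm (H.ax3 q p)))

theorem Prf.by_contra (h : H.Prf (insert (H.neg p) Γ) q)
    (h' : H.Prf (insert (H.neg p) Γ) (H.neg q)) : H.Prf Γ p :=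
  .mp (.thm (thm_imp_self q)) (.mp (h.exfalso h' (H.neg (H.imp q q))).intro (.thm (H.ax3 _ _)))

theorem Prf.of_neg_neg (h : H.Prf Γ (H.neg (H.neg p))) : H.Prf Γ p :=
  Prf.by_contra (.hyp (Set.mem_insert _ _)) (h.weaken (Set.subset_insert _ _))

theorem Prf.neg_intro (h : H.Prf (insert p Γ) q) (h' : H.Prf (insert p Γ) (H.neg q)) :
    H.Prf Γ (H.neg p) := by
  have key {s : F} (hs : H.Prf (insert p Γ) s) :
      H.Prf (insert (H.neg (H.neg p)) Γ) s :=
    .mp (Prf.of_neg_neg (.hyp (Set.mem_insert _ _))) (hs.intro.weaken (Set.subset_insert _ _))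
  exact Prf.by_contra (key h) (key h')

theorem Prf.and_intro (h : H.Prf Γ p) (h' : H.Prf Γ q) :
    H.Prf Γ (H.neg (H.imp p (H.neg q))) :=
  Prf.neg_intro (h'.weaken (Set.subset_insert _ _))
    (.mp (h.weaken (Set.subset_insert _ _)) (.hyp (Set.mem_insert _ _)))

theorem Prf.and_left (h : H.Prf Γ (H.neg (H.imp p (H.neg q)))) : H.Prf Γ p :=
  Prf.by_contra (q := H.imp p (H.neg q))
    (Prf.intro (Prf.exfalso (p := p) (.hyp (by simp)) (.hyp (by simp)) _))
    (h.weaken (Set.subset_insert _ _))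

theorem Prf.and_right (h : H.Prf Γ (H.neg (H.imp p (H.neg q)))) : H.Prf Γ q :=
  Prf.by_contra (q := H.imp p (H.neg q)) (Prf.imp_of (.hyp (Set.mem_insert _ _)))
    (h.weaken (Set.subset_insert _ _))

theorem Prf.or_elim (h : H.Prf Γ (H.imp (H.neg p) q)) (hp : H.Prf (insert p Γ) r)
    (hq : H.Prf (insert q Γ) r) : H.Prf Γ r := by
  have hΓ : Γ ⊆ insert (H.neg r) Γ := Set.subset_insert _ _
  have hn : H.Prf (insert (H.neg r) Γ) (H.neg p) :=
    Prf.neg_intro (q := r) (hp.weaken (Set.insert_subset_insert hΓ))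
      (.hyp (Set.mem_insert_of_mem _ (Set.mem_insert _ _)))
  exact Prf.by_contra (q := r) (.mp (.mp hn (h.weaken hΓ)) (hq.intro.weaken hΓ))
    (.hyp (Set.mem_insert _ _))

variable (H) in
/-- Provable equivalence. -/
def setoid : Setoid F where
  r p q := H.Thm (H.imp p q) ∧ H.Thm (H.imp q p)
  iseqv :=
    { refl p := ⟨thm_imp_self p, thm_imp_self p⟩
      symm h := ⟨h.2, h.1⟩
      trans {p q r} h h' := by
        have tr {a b c : F} (h : H.Thm (H.imp a b)) (h' : H.Thm (H.imp b c)) :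
            H.Thm (H.imp a c) := H.mp h (H.mp (H.mp h' (H.ax1 _ _)) (H.ax2 _ _ _))
        exact ⟨tr h.1 h'.1, tr h'.2 h.2⟩ }

variable (H) in
/-- The Lindenbaum algebra of a Hilbert system. -/
def Lindenbaum : Type := Quotient H.setoid

variable (H) in
/-- The class of a formula in the Lindenbaum algebra. -/
def cls (p : F) : H.Lindenbaum := Quotient.mk H.setoid p

theorem cls_surjective : Function.Surjective H.cls := Quotient.mk_surjective

theorem thm_imp_iff : H.Thm (H.imp p q) ↔ H.Prf {p} q := by
  constructor
  · intro h
    exact .mp (.hyp rfl) (.thm h)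
  · intro h
    exact Prf.toThm (Prf.intro (by simpa using h))

theorem cls_sound (h : H.setoid p q) : H.cls p = H.cls q := Quotient.sound h

theorem setoid_of_cls_eq (h : H.cls p = H.cls q) : H.setoid p q := Quotient.exact h

theorem cls_eq_iff : H.cls p = H.cls q ↔ H.Prf {p} q ∧ H.Prf {q} p := by
  rw [← thm_imp_iff, ← thm_imp_iff]
  exact Quotient.eq (r := H.setoid)

theorem Prf.cut (h : H.Prf Γ p) (h' : H.Prf {p} q) : H.Prf Γ q :=
  .mp h (.thm (thm_imp_iff.2 h'))

theorem Prf.contra (h : H.Prf {p} q) : H.Prf {H.neg q} (H.neg p) :=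
  Prf.neg_intro (q := q) ((Prf.hyp (Set.mem_insert _ _)).cut h)
    (.hyp (Set.mem_insert_of_mem _ rfl))

theorem Prf.imp_congr {p' q' : F} (hp : H.Prf {p'} p) (hq : H.Prf {q} q') :
    H.Prf {H.imp p q} (H.imp p' q') :=
  Prf.intro (.cut (.mp ((Prf.hyp (Set.mem_insert _ _)).cut hp)
    (.hyp (Set.mem_insert_of_mem _ rfl))) hq)

/-- With entailment from one premise as the order, the lattice laws become natural deduction rules.
-/
instance : PartialOrder H.Lindenbaum where
  le := Quotient.lift₂ (fun p q => H.Prf {p} q) (by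
    intro a b a' b' h h'
    have h := cls_eq_iff.1 (Quotient.sound h)
    have h' := cls_eq_iff.1 (Quotient.sound h')
    exact propext ⟨fun k => (h.2.cut k).cut h'.1, fun k => (h.1.cut k).cut h'.2⟩)
  le_refl := by
    rintro ⟨p⟩
    exact Prf.hyp rfl
  le_trans := by
    rintro ⟨p⟩ ⟨q⟩ ⟨r⟩ h h'
    exact Prf.cut h h'
  le_antisymm := by
    rintro ⟨p⟩ ⟨q⟩ h h'
    exact cls_eq_iff.2 ⟨h, h'⟩

theorem cls_le : H.cls p ≤ H.cls q ↔ H.Prf {p} q := Iff.rfl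

/-- Join and meet are literally the abbreviations `sor` and `sand`, so classes of such formulas are
computed by `rfl`. -/
instance : BooleanAlgebra H.Lindenbaum where
  sup := Quotient.map₂ (fun p q => H.imp (H.neg p) q) (by
    intro a b h a' b' h'
    have h := cls_eq_iff.1 (Quotient.sound h)
    have h' := cls_eq_iff.1 (Quotient.sound h')
    exact Quotient.exact (cls_eq_iff.2 ⟨h.1.contra.imp_congr h'.1, h.2.contra.imp_congr h'.2⟩))
  inf := Quotient.map₂ (fun p q => H.neg (H.imp p (H.neg q))) (by
    intro a b h a' b' h'
    have h := cls_eq_iff.1 (Quotient.sound h)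
    have h' := cls_eq_iff.1 (Quotient.sound h')
    exact Quotient.exact (cls_eq_iff.2
      ⟨(h.1.imp_congr h'.1.contra).contra, (h.2.imp_congr h'.2.contra).contra⟩))
  compl := Quotient.map H.neg (by
    intro a b h
    have h := cls_eq_iff.1 (Quotient.sound h)
    exact Quotient.exact (cls_eq_iff.2 ⟨h.2.contra, h.1.contra⟩))
  top := H.cls (H.imp H.base H.base)
  bot := H.cls (H.neg (H.imp H.base H.base))
  le_sup_left := by
    rintro ⟨p⟩ ⟨q⟩
    exact Prf.intro (Prf.exfalso (p := p) (.hyp (by simp)) (.hyp (by simp)) _)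
  le_sup_right := by
    rintro ⟨p⟩ ⟨q⟩
    exact Prf.imp_of (.hyp rfl)
  sup_le := by
    rintro ⟨p⟩ ⟨q⟩ ⟨r⟩ h h'
    exact Prf.or_elim (.hyp rfl) ((Prf.hyp (Set.mem_insert _ _)).cut h)
      ((Prf.hyp (Set.mem_insert _ _)).cut h')
  inf_le_left := by
    rintro ⟨p⟩ ⟨q⟩
    exact Prf.and_left (.hyp rfl)
  inf_le_right := by
    rintro ⟨p⟩ ⟨q⟩
    exact Prf.and_right (.hyp rfl)
  le_inf := by
    rintro ⟨p⟩ ⟨q⟩ ⟨r⟩ h h'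
    exact Prf.and_intro h h'
  le_sup_inf := by
    rintro ⟨p⟩ ⟨q⟩ ⟨r⟩
    exact Prf.intro (.and_intro
      (.mp (.hyp (Set.mem_insert _ _)) (Prf.and_left (.hyp (Set.mem_insert_of_mem _ rfl))))
      (.mp (.hyp (Set.mem_insert _ _)) (Prf.and_right (.hyp (Set.mem_insert_of_mem _ rfl)))))
  le_top := by
    rintro ⟨p⟩
    exact Prf.thm (thm_imp_self _)
  bot_le := by
    rintro ⟨p⟩
    change H.Prf {H.neg (H.imp H.base H.base)} p
    exact Prf.exfalso (.thm (thm_imp_self H.base)) (.hyp (Set.mem_singleton _)) p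
  inf_compl_le_bot := by
    rintro ⟨p⟩
    change H.Prf {H.neg (H.imp p (H.neg (H.neg p)))} _
    exact Prf.exfalso (Prf.and_left (.hyp (Set.mem_singleton _)))
      (Prf.and_right (.hyp (Set.mem_singleton _))) _
  top_le_sup_compl := by
    rintro ⟨p⟩
    exact Prf.thm (thm_imp_self _)

theorem cls_neg : H.cls (H.neg p) = (H.cls p)ᶜ := rfl

theorem cls_or : H.cls (H.imp (H.neg p) q) = H.cls p ⊔ H.cls q := rfl

theorem cls_and : H.cls (H.neg (H.imp p (H.neg q))) = H.cls p ⊓ H.cls q := rfl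

theorem cls_le_cls_iff : H.cls p ≤ H.cls q ↔ H.Thm (H.imp p q) := cls_le.trans thm_imp_iff.symm

theorem cls_eq_top_iff : H.cls p = ⊤ ↔ H.Thm p := by
  rw [← top_le_iff]
  change H.Prf _ p ↔ _
  rw [← thm_imp_iff]
  exact ⟨H.mp (thm_imp_self _), fun h => H.mp h (H.ax1 _ _)⟩

/-- The Heyting implication unfolds to the class of ¬¬p → q, so double negation has to be removed.
-/
theorem cls_imp : H.cls (H.imp p q) = H.cls p ⇨ H.cls q := by
  rw [himp_eq, sup_comm, ← cls_neg, ← cls_or]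
  have h : H.Prf {H.neg (H.neg p)} p := Prf.of_neg_neg (.hyp rfl)
  have h' : H.Prf {p} (H.neg (H.neg p)) := Prf.neg_intro (q := p) (.hyp (by simp)) (.hyp (by simp))
  exact cls_eq_iff.2 ⟨h.imp_congr (.hyp rfl), h'.imp_congr (.hyp rfl)⟩

end HilbertSystem

/-! ### Team algebras and nonempty witnesses -/

/-- Boolean algebras `M` of flat and `B` of arbitrary team properties, with the embedding `e` of
flat properties, the splitting operator and the two modalities. -/
structure TeamAlgebra (M B : Type) [BooleanAlgebra M] [BooleanAlgebra B] where
  e : M → B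
  tensor : B → B → B
  box : B → B
  dia : B → B
  boxM : M → M
  e_top : e ⊤ = ⊤
  e_himp (a b : M) : e (a ⇨ b) ≤ e a ⇨ e b
  e_sup (a b : M) : e (a ⊔ b) = tensor (e a) (e b)
  tensor_bot (x : B) : tensor x ⊥ = ⊥
  tensor_sup (x y z : B) : tensor x (y ⊔ z) = tensor x y ⊔ tensor x z
  tensor_comm (x y : B) : tensor x y = tensor y x
  tensor_left_comm (x y z : B) : tensor x (tensor y z) = tensor y (tensor x z)
  -- Flat properties pass to the parts of a splitting.
  tensor_flat (a : M) (x : B) : e a ⊓ tensor x (e a)ᶜ = ⊥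
  -- Lax semantics: the parts may overlap, so the whole team can itself serve as the first part.
  tensor_lax (x y z : B) : x ⊓ tensor z y ≤ tensor x y
  box_compl (x : B) : box xᶜ = (box x)ᶜ
  box_sup (x y : B) : box (x ⊔ y) = box x ⊔ box y
  box_e (a : M) : box (e a) = e (boxM a)
  boxM_top : boxM ⊤ = ⊤
  dia_bot : dia ⊥ = ⊥
  dia_sup (x y : B) : dia (x ⊔ y) = dia x ⊔ dia y
  dia_tensor (x y : B) : dia (tensor x y) = tensor (dia x) (dia y)
  dia_e (a : M) : dia (e a) = e (boxM aᶜ)ᶜ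
  box_flat (a : M) : e (boxM a) ⊓ dia (e a)ᶜ = ⊥

namespace TeamAlgebra

variable {M B : Type} [BooleanAlgebra M] [BooleanAlgebra B] (A : TeamAlgebra M B)

theorem e_mono {a b : M} (h : a ≤ b) : A.e a ≤ A.e b := by
  have := A.e_himp a b
  rwa [himp_eq_top_iff.2 h, A.e_top, top_le_iff, himp_eq_top_iff] at this

theorem e_inf (a b : M) : A.e (a ⊓ b) = A.e a ⊓ A.e b := by
  refine le_antisymm (le_inf (A.e_mono inf_le_left) (A.e_mono inf_le_right)) ?_
  rw [inf_comm, ← le_himp_iff]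
  exact (A.e_mono (by rw [le_himp_iff, inf_comm])).trans (A.e_himp a (a ⊓ b))

theorem tensor_mono {x y x' y' : B} (hx : x ≤ x') (hy : y ≤ y') :
    A.tensor x y ≤ A.tensor x' y' := by
  have key (z : B) {u v : B} (h : u ≤ v) : A.tensor z u ≤ A.tensor z v := by
    rw [← sup_eq_right.2 h, A.tensor_sup]
    exact le_sup_left
  refine (key x hy).trans ?_
  rw [A.tensor_comm x, A.tensor_comm x']
  exact key y' hx

theorem dia_mono {x y : B} (h : x ≤ y) : A.dia x ≤ A.dia y := by
  rw [← sup_eq_right.2 h, A.dia_sup]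
  exact le_sup_left

/-- A nonempty subteam all of whose members satisfy `a`. -/
def witness (a : M) : B := (A.e ⊥)ᶜ ⊓ A.e a

/-- Split `y` by whether `e a` holds; the part where it fails is excluded by `tensor_flat`. -/
theorem e_inf_tensor_le (a : M) (x y : B) :
    A.e a ⊓ A.tensor x y ≤ A.tensor x (y ⊓ A.e a) := by
  have h : A.tensor x y ≤ A.tensor x (y ⊓ A.e a) ⊔ A.tensor x (A.e a)ᶜ := by
    rw [← A.tensor_sup]
    refine A.tensor_mono le_rfl ?_
    rw [sup_inf_right, sup_compl_eq_top, inf_top_eq]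
    exact le_sup_left
  refine (inf_le_inf_left _ h).trans ?_
  rw [inf_sup_left, A.tensor_flat, sup_bot_eq]
  exact inf_le_right

/-- A team violates ¬a exactly when it has a nonempty subteam satisfying a. For the lower bound,
split the team into its ¬a part and its a part: if the latter is empty, the whole team satisfies ¬a.
-/
theorem tensor_witness (a : M) : A.tensor ⊤ (A.witness a) = (A.e aᶜ)ᶜ := by
  apply le_antisymm
  · rw [le_compl_iff_disjoint_left, disjoint_iff_inf_le]
    refine (A.e_inf_tensor_le _ _ _).trans ?_
    rw [witness, inf_assoc, ← A.e_inf, inf_compl_eq_bot, compl_inf_eq_bot, A.tensor_bot]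
  · have h : (⊤ : B) = A.tensor (A.e aᶜ) (A.e a ⊓ A.e ⊥) ⊔ A.tensor (A.e aᶜ) (A.witness a) := by
      rw [witness, inf_comm _ (A.e a), ← A.tensor_sup, ← inf_sup_left, sup_compl_eq_top,
        inf_top_eq, ← A.e_sup, compl_sup_eq_top, A.e_top]
    rw [← A.e_inf, inf_bot_eq, ← A.e_sup, sup_bot_eq] at h
    have h' : (A.e aᶜ)ᶜ ≤ A.tensor (A.e aᶜ) (A.witness a) := by
      rw [← codisjoint_iff_compl_le_right, codisjoint_iff, ← h]
    exact h'.trans (A.tensor_mono le_top le_rfl)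

/-- ◇ preserves emptiness and nonemptiness of the team: the empty team satisfies □⊥, hence all its
successor teams are empty, and ◇⊥ is ⊥ on flat properties. -/
theorem dia_witness (a : M) : A.dia (A.witness a) = A.witness (A.boxM aᶜ)ᶜ := by
  have hbot : A.dia (A.e ⊥) = A.e ⊥ := by rw [A.dia_e, compl_bot, A.boxM_top, compl_top]
  apply le_antisymm
  · refine le_inf ?_ ((A.dia_mono inf_le_right).trans (A.dia_e a).le)
    refine (A.dia_mono inf_le_left).trans ?_
    rw [le_compl_iff_disjoint_left, disjoint_iff_inf_le, ← A.box_flat ⊥]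
    exact inf_le_inf_right _ (A.e_mono bot_le)
  · have h : A.dia (A.e a) ≤ A.e ⊥ ⊔ A.dia (A.witness a) := by
      rw [← hbot, ← A.dia_sup]
      refine A.dia_mono ?_
      rw [witness, sup_inf_left, sup_compl_eq_top, top_inf_eq]
      exact le_sup_right
    rw [witness, ← A.dia_e]
    refine (inf_le_inf_left _ h).trans ?_
    rw [inf_sup_left, compl_inf_eq_bot, bot_sup_eq]
    exact inf_le_right

/-! ### Terms: pulling negated flat properties out of ⊗ and ◇ -/

/-- Conjunctions of a flat property `a` with negations of flat properties. -/
inductive IsTerm (a : M) : B → Prop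
  | flat : IsTerm a (A.e a)
  | cut {x : B} (b : M) : IsTerm a x → IsTerm a (x ⊓ (A.e b)ᶜ)

variable {A}

namespace IsTerm

variable {a c : M} {x y : B}

theorem le_e (h : A.IsTerm a x) : x ≤ A.e a := by
  induction h with
  | flat => exact le_rfl
  | cut b _ ih => exact inf_le_left.trans ih

theorem tensor_compl_e_le (b : M) (x : B) : A.tensor x (A.e b)ᶜ ≤ (A.e b)ᶜ := by
  rw [le_compl_iff_disjoint_left, disjoint_iff]
  exact A.tensor_flat b x

/-- Adding points that satisfy `a` to a team keeps the flat part of the term, and negated flat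
properties are upward closed. -/
theorem tensor_le {z : B} (h : A.IsTerm a x) (hz : z ≤ A.e a) : A.tensor z x ≤ x := by
  induction h with
  | flat => exact (A.tensor_mono hz le_rfl).trans (by rw [← A.e_sup, sup_idem])
  | cut b _ ih =>
    exact le_inf ((A.tensor_mono le_rfl inf_le_left).trans ih)
      ((A.tensor_mono le_rfl inf_le_right).trans (tensor_compl_e_le b z))

theorem tensor_witness_le (h : A.IsTerm a x) (b : M) :
    A.tensor x (A.witness (a ⊓ bᶜ)) ≤ x ⊓ (A.e b)ᶜ := by
  apply le_inf
  · rw [A.tensor_comm]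
    exact h.tensor_le (inf_le_right.trans (A.e_mono inf_le_left))
  · refine (A.tensor_mono le_top le_rfl).trans ?_
    rw [A.tensor_witness, compl_le_compl_iff_le]
    exact A.e_mono (by simp)

theorem cut_le (h : A.IsTerm a x) (b : M) :
    x ⊓ (A.e b)ᶜ ≤ A.tensor ⊤ (A.witness (a ⊓ bᶜ)) := by
  rw [A.tensor_witness, le_compl_iff_disjoint_left, disjoint_iff_inf_le]
  have : A.e (a ⊓ bᶜ)ᶜ ⊓ A.e a ≤ A.e b := by
    rw [← A.e_inf]
    refine A.e_mono ?_
    rw [compl_inf, compl_compl, inf_sup_right, compl_inf_eq_bot, bot_sup_eq]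
    exact inf_le_left
  calc A.e (a ⊓ bᶜ)ᶜ ⊓ (x ⊓ (A.e b)ᶜ) ≤ (A.e (a ⊓ bᶜ)ᶜ ⊓ A.e a) ⊓ (A.e b)ᶜ := by
        rw [← inf_assoc]
        exact inf_le_inf_right _ (inf_le_inf_left _ h.le_e)
    _ ≤ A.e b ⊓ (A.e b)ᶜ := inf_le_inf_right _ this
    _ = ⊥ := inf_compl_eq_bot

/-- A violation of `b` in the `x` part is a witness for `a ⊓ bᶜ` in the whole team. Conversely
`tensor_lax` splits off such a witness, and reassociating merges it into the `x` part, which stays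
an `x` team by `tensor_witness_le`. -/
theorem tensor_cut (h : A.IsTerm a x) (b : M) (y : B) :
    A.tensor y (x ⊓ (A.e b)ᶜ) = A.tensor y x ⊓ (A.e (a ⊓ bᶜ)ᶜ)ᶜ := by
  apply le_antisymm
  · refine le_inf (A.tensor_mono le_rfl inf_le_left) ?_
    refine (A.tensor_mono le_rfl ((h.cut_le b).trans (A.tensor_witness _).le)).trans ?_
    exact tensor_compl_e_le _ _
  · rw [← A.tensor_witness]
    refine (A.tensor_lax _ _ _).trans ?_
    rw [A.tensor_comm, A.tensor_left_comm, A.tensor_comm _ x]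
    exact A.tensor_mono le_rfl (h.tensor_witness_le b)

/-- As in `tensor_cut`, with `dia_tensor` and `dia_witness` carrying the witness between a team and
its successor team. -/
theorem dia_cut (h : A.IsTerm a x) (b : M) :
    A.dia (x ⊓ (A.e b)ᶜ) = A.dia x ⊓ (A.e (A.boxM (a ⊓ bᶜ)ᶜ))ᶜ := by
  have hw : A.tensor ⊤ (A.dia (A.witness (a ⊓ bᶜ))) = (A.e (A.boxM (a ⊓ bᶜ)ᶜ))ᶜ := by
    rw [dia_witness, A.tensor_witness, compl_compl]
  rw [← hw]
  apply le_antisymm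
  · refine le_inf (A.dia_mono inf_le_left) ((A.dia_mono (h.cut_le b)).trans ?_)
    rw [A.dia_tensor]
    exact A.tensor_mono le_top le_rfl
  · refine (A.tensor_lax _ _ _).trans ?_
    rw [← A.dia_tensor]
    exact A.dia_mono (h.tensor_witness_le b)

theorem tensor (hx : A.IsTerm a x) (hy : A.IsTerm c y) : A.IsTerm (a ⊔ c) (A.tensor x y) := by
  induction hy with
  | flat =>
    rw [A.tensor_comm]
    induction hx with
    | flat =>
      rw [← A.e_sup, sup_comm]
      exact .flat
    | cut b hx ih =>
      rw [hx.tensor_cut b]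
      exact .cut _ ih
  | cut b hy ih =>
    rw [hy.tensor_cut b]
    exact .cut _ ih

theorem dia (hx : A.IsTerm a x) : A.IsTerm (A.boxM aᶜ)ᶜ (A.dia x) := by
  induction hx with
  | flat =>
    rw [A.dia_e]
    exact .flat
  | cut b hx ih =>
    rw [hx.dia_cut b]
    exact .cut _ ih

theorem inf (hx : A.IsTerm a x) (hy : A.IsTerm c y) : A.IsTerm (a ⊓ c) (x ⊓ y) := by
  induction hy with
  | flat =>
    induction hx with
    | flat =>
      rw [← A.e_inf]
      exact .flat
    | cut b _ ih =>
      rw [inf_right_comm]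
      exact .cut b ih
  | cut b _ ih =>
    rw [← inf_assoc]
    exact .cut b ih

end IsTerm

/-! ### Normal forms and their closure under all operations -/

variable (A) in
/-- Finite joins of terms. -/
inductive IsNormal : B → Prop
  | term {a : M} {x : B} : A.IsTerm a x → IsNormal x
  | sup {x y : B} : IsNormal x → IsNormal y → IsNormal (x ⊔ y)

namespace IsNormal

variable {x y : B}

theorem e (a : M) : A.IsNormal (A.e a) := .term .flat

theorem compl_e (a : M) : A.IsNormal (A.e a)ᶜ := by
  have := (IsTerm.flat (A := A) (a := ⊤)).cut a
  rw [A.e_top, top_inf_eq] at this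
  exact .term this

theorem inf (hx : A.IsNormal x) (hy : A.IsNormal y) : A.IsNormal (x ⊓ y) := by
  induction hx with
  | term hx =>
    induction hy with
    | term hy => exact .term (hx.inf hy)
    | sup _ _ ih₁ ih₂ =>
      rw [inf_sup_left]
      exact .sup ih₁ ih₂
  | sup _ _ ih₁ ih₂ =>
    rw [inf_sup_right]
    exact .sup ih₁ ih₂

theorem compl (hx : A.IsNormal x) : A.IsNormal xᶜ := by
  induction hx with
  | term hx =>
    induction hx with
    | flat => exact compl_e _
    | cut b _ ih =>
      rw [compl_inf, compl_compl]
      exact .sup ih (e b)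
  | sup _ _ ih₁ ih₂ =>
    rw [compl_sup]
    exact ih₁.inf ih₂

theorem tensor (hx : A.IsNormal x) (hy : A.IsNormal y) : A.IsNormal (A.tensor x y) := by
  induction hy with
  | term hy =>
    induction hx with
    | term hx => exact .term (hx.tensor hy)
    | sup _ _ ih₁ ih₂ =>
      rw [A.tensor_comm _ _] at ih₁ ih₂ ⊢
      rw [A.tensor_sup]
      exact .sup ih₁ ih₂
  | sup _ _ ih₁ ih₂ =>
    rw [A.tensor_sup]
    exact .sup ih₁ ih₂

theorem dia (hx : A.IsNormal x) : A.IsNormal (A.dia x) := by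
  induction hx with
  | term hx => exact .term hx.dia
  | sup _ _ ih₁ ih₂ =>
    rw [A.dia_sup]
    exact .sup ih₁ ih₂

theorem box (hx : A.IsNormal x) : A.IsNormal (A.box x) := by
  induction hx with
  | term hx =>
    induction hx with
    | flat =>
      rw [A.box_e]
      exact e _
    | cut b _ ih =>
      -- The meet is written through complements and joins, both of which `box` preserves.
      rw [← compl_compl (_ ⊓ _), A.box_compl, compl_inf, A.box_sup, A.box_compl, compl_sup,
        compl_compl, A.box_compl, A.box_compl, compl_compl, A.box_e]
      exact ih.inf (compl_e _)
  | sup _ _ ih₁ ih₂ =>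
    rw [A.box_sup]
    exact .sup ih₁ ih₂

end IsNormal

end TeamAlgebra

/-! ### The calculus as a team algebra -/

open Formula HilbertSystem

/-- Classical modal formulas, as a type. -/
abbrev FlatFormula : Type := {a // a ∈ ML}

/-- Modal team logic formulas, as a type. -/
abbrev TeamFormula : Type := {f // f ∈ MTL}

theorem ML_subset_MTL : ML ⊆ MTL := fun _ h => .base h

theorem Derives.mono {Φ Ψ : Set Formula} {f : Formula} (h : Φ ⊆ Ψ) (hf : Derives Φ f) :
    Derives Ψ f := by
  induction hf with
  | premise hf => exact .premise (h hf)
  | axH hf => exact .axH hf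
  | axL hf => exact .axL hf
  | axS hf => exact .axS hf
  | axM hf => exact .axM hf
  | mpImp ha hb _ _ ih₁ ih₂ => exact .mpImp ha hb (ih₁ h) (ih₂ h)
  | necML ha hf => exact .necML ha hf
  | mpMimp ha hb _ _ ih₁ ih₂ => exact .mpMimp ha hb (ih₁ h) (ih₂ h)
  | necLimp hf hg hd => exact .necLimp hf hg hd
  | necBox hf hd => exact .necBox hf hd
  | necDelta hf hd => exact .necDelta hf hd

/-- The classical fragment. -/
def flatSystem : HilbertSystem FlatFormula where
  imp a b := ⟨imp a b, .imp a.2 b.2⟩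
  neg a := ⟨neg a, .neg a.2⟩
  -- This base makes the bottom of `Flat` the class of the formula `bot` itself, so `NE` represents
  -- `(e ⊥)ᶜ` definitionally.
  base := ⟨atom 0, .atom 0⟩
  Thm a := Derives ∅ a
  mp {a b} h h' := .mpImp a.2 b.2 h h'
  ax1 a b := .axH (.A1 a.2 b.2)
  ax2 a b c := .axH (.A2 a.2 b.2 c.2)
  ax3 a b := .axH (.A3 a.2 b.2)

/-- The material fragment, with all formulas of modal team logic as atoms. -/
def teamSystem : HilbertSystem TeamFormula where
  imp f g := ⟨mimp f g, .mimp f.2 g.2⟩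
  neg f := ⟨snot f, .snot f.2⟩
  base := ⟨atom 0, ML_subset_MTL (.atom 0)⟩
  Thm f := Derives ∅ f
  mp {f g} h h' := .mpMimp f.2 g.2 h h'
  ax1 f g := .axL (.L1 f.2 g.2)
  ax2 f g h := .axL (.L2 f.2 g.2 h.2)
  ax3 f g := .axL (.L3 f.2 g.2)

/-- Classical modal formulas modulo provable equivalence. -/
abbrev Flat : Type := flatSystem.Lindenbaum

/-- Modal team logic formulas modulo provable equivalence. -/
abbrev Team : Type := teamSystem.Lindenbaum

/-- The inclusion of classical formulas. -/
def flatIncl (a : FlatFormula) : TeamFormula := ⟨a, ML_subset_MTL a.2⟩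

theorem team_le_iff {f g : TeamFormula} :
    teamSystem.cls f ≤ teamSystem.cls g ↔ Derives ∅ (mimp f g) := cls_le_cls_iff

/-- Turns each equivalence axiom into an equation between classes. -/
theorem team_eq_iff {f g : TeamFormula} :
    teamSystem.cls f = teamSystem.cls g ↔ Derives ∅ (siff f g) := by
  have h : teamSystem.cls ⟨siff f g, .snot (.mimp (.mimp f.2 g.2) (.snot (.mimp g.2 f.2)))⟩ =
      teamSystem.cls (teamSystem.imp f g) ⊓ teamSystem.cls (teamSystem.imp g f) :=
    cls_and (p := teamSystem.imp f g) (q := teamSystem.imp g f)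
  have h' := cls_eq_top_iff (H := teamSystem)
    (p := ⟨siff f g, .snot (.mimp (.mimp f.2 g.2) (.snot (.mimp g.2 f.2)))⟩)
  rw [h, inf_eq_top_iff, cls_imp, cls_imp, himp_eq_top_iff, himp_eq_top_iff,
    ← le_antisymm_iff] at h'
  exact h'

/-- `⊸` on formulas of modal team logic. -/
def TeamFormula.limp (f g : TeamFormula) : TeamFormula := ⟨.limp f g, .limp f.2 g.2⟩

/-- `□` on formulas of modal team logic. -/
def TeamFormula.box (f : TeamFormula) : TeamFormula := ⟨.box f, .box f.2⟩

/-- `Δ` on formulas of modal team logic. -/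
def TeamFormula.delta (f : TeamFormula) : TeamFormula := ⟨.delta f, .delta f.2⟩

/-- `□` on classical formulas. -/
def FlatFormula.box (a : FlatFormula) : FlatFormula := ⟨.box a, .box a.2⟩

namespace Team

/-- Elimination of implications derivable in modal team logic. -/
theorem le_himp {f g h : TeamFormula} (k : Derives ∅ (mimp f (mimp g h))) :
    teamSystem.cls f ≤ teamSystem.cls g ⇨ teamSystem.cls h := by
  rw [← cls_imp]
  exact team_le_iff.2 k

theorem limp_mono_right (h : TeamFormula) {f g : TeamFormula} (hfg : teamSystem.cls f ≤ teamSystem.cls g) :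
    teamSystem.cls (h.limp f) ≤ teamSystem.cls (h.limp g) :=
  team_le_iff.2 (.mpMimp (h.limp (teamSystem.imp f g)).2
    (teamSystem.imp (h.limp f) (h.limp g)).2
    (.necLimp (teamSystem.imp f g).2 h.2 (team_le_iff.1 hfg)) (.axS (.Dis h.2 f.2 g.2)))

theorem limp_neg_comm (f g : TeamFormula) :
    teamSystem.cls (f.limp (teamSystem.neg g)) = teamSystem.cls (g.limp (teamSystem.neg f)) :=
  le_antisymm (team_le_iff.2 (.axS (.C f.2 g.2))) (team_le_iff.2 (.axS (.C g.2 f.2)))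

theorem cls_neg_neg (f : TeamFormula) :
    teamSystem.cls (teamSystem.neg (teamSystem.neg f)) = teamSystem.cls f := by
  rw [cls_neg, cls_neg, compl_compl]

theorem limp_congr_right (h : TeamFormula) {f g : TeamFormula} (hfg : teamSystem.cls f = teamSystem.cls g) :
    teamSystem.cls (h.limp f) = teamSystem.cls (h.limp g) :=
  le_antisymm (limp_mono_right h hfg.le) (limp_mono_right h hfg.ge)

/-- Necessitation and `Dis` control only the right argument of ⊸; the contraposition axiom `C` moves
the left argument there. -/
theorem limp_congr {f f' g g' : TeamFormula} (hf : teamSystem.cls f = teamSystem.cls f')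
    (hg : teamSystem.cls g = teamSystem.cls g') :
    teamSystem.cls (f.limp g) = teamSystem.cls (f'.limp g') := by
  have key (f : TeamFormula) : teamSystem.cls (f.limp g') =
      teamSystem.cls ((teamSystem.neg g').limp (teamSystem.neg f)) := by
    rw [← limp_neg_comm]
    exact limp_congr_right f (cls_neg_neg g').symm
  rw [limp_congr_right f hg, key f, key f']
  apply limp_congr_right
  rw [cls_neg, cls_neg, hf]

theorem box_mono {f g : TeamFormula} (hfg : teamSystem.cls f ≤ teamSystem.cls g) :
    teamSystem.cls f.box ≤ teamSystem.cls g.box :=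
  team_le_iff.2 (.mpMimp (teamSystem.imp f g).box.2 (teamSystem.imp f.box g.box).2
    (.necBox (teamSystem.imp f g).2 (team_le_iff.1 hfg)) (.axM (.DisBox f.2 g.2)))

theorem delta_mono {f g : TeamFormula} (hfg : teamSystem.cls f ≤ teamSystem.cls g) :
    teamSystem.cls f.delta ≤ teamSystem.cls g.delta :=
  team_le_iff.2 (.mpMimp (teamSystem.imp f g).delta.2 (teamSystem.imp f.delta g.delta).2
    (.necDelta (teamSystem.imp f g).2 (team_le_iff.1 hfg)) (.axM (.DisDelta f.2 g.2)))

/-- `⊸` on the Lindenbaum algebra. -/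
def limp : Team → Team → Team :=
  Quotient.map₂ TeamFormula.limp fun _ _ h _ _ h' =>
    setoid_of_cls_eq (limp_congr (cls_sound h) (cls_sound h'))

/-- `□` on the Lindenbaum algebra. -/
def box : Team → Team :=
  Quotient.map TeamFormula.box fun _ _ h => setoid_of_cls_eq
    (le_antisymm (box_mono (cls_sound h).le) (box_mono (cls_sound h).ge))

/-- `Δ` on the Lindenbaum algebra. -/
def delta : Team → Team :=
  Quotient.map TeamFormula.delta fun _ _ h => setoid_of_cls_eq
    (le_antisymm (delta_mono (cls_sound h).le) (delta_mono (cls_sound h).ge))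

theorem cls_limp (f g : TeamFormula) :
    teamSystem.cls (f.limp g) = limp (teamSystem.cls f) (teamSystem.cls g) := rfl

theorem cls_delta (f : TeamFormula) : teamSystem.cls f.delta = delta (teamSystem.cls f) := rfl

variable (x y z : Team)

theorem limp_compl_comm : limp x yᶜ = limp y xᶜ := by
  obtain ⟨f, rfl⟩ := cls_surjective x
  obtain ⟨g, rfl⟩ := cls_surjective y
  exact limp_neg_comm f g

theorem limp_left_comm : limp x (limp y z) = limp y (limp x z) := by
  obtain ⟨f, rfl⟩ := cls_surjective x
  obtain ⟨g, rfl⟩ := cls_surjective y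
  obtain ⟨h, rfl⟩ := cls_surjective z
  exact le_antisymm (team_le_iff.2 (.axS (.Ex f.2 g.2 h.2)))
    (team_le_iff.2 (.axS (.Ex g.2 f.2 h.2)))

theorem limp_lax : x ≤ limp x y ⇨ limp z y := by
  obtain ⟨f, rfl⟩ := cls_surjective x
  obtain ⟨g, rfl⟩ := cls_surjective y
  obtain ⟨h, rfl⟩ := cls_surjective z
  exact le_himp (f := f) (g := f.limp g) (h := h.limp g) (.axS (.Lax f.2 g.2 h.2))

theorem limp_top : limp x ⊤ = ⊤ := by
  obtain ⟨f, rfl⟩ := cls_surjective x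
  exact cls_eq_top_iff.2
    (.necLimp (teamSystem.imp _ _).2 f.2 (thm_imp_self (H := teamSystem) teamSystem.base))

theorem limp_himp : limp x (y ⇨ z) ≤ limp x y ⇨ limp x z := by
  obtain ⟨f, rfl⟩ := cls_surjective x
  obtain ⟨g, rfl⟩ := cls_surjective y
  obtain ⟨h, rfl⟩ := cls_surjective z
  rw [← cls_imp]
  exact le_himp (f := f.limp (teamSystem.imp g h)) (g := f.limp g) (h := f.limp h)
    (.axS (.Dis f.2 g.2 h.2))

theorem delta_top : delta ⊤ = ⊤ :=
  cls_eq_top_iff.2 (.necDelta (teamSystem.imp _ _).2 (thm_imp_self (H := teamSystem) teamSystem.base))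

theorem delta_himp : delta (x ⇨ y) ≤ delta x ⇨ delta y := by
  obtain ⟨f, rfl⟩ := cls_surjective x
  obtain ⟨g, rfl⟩ := cls_surjective y
  rw [← cls_imp]
  exact le_himp (f := (teamSystem.imp f g).delta) (g := f.delta) (h := g.delta)
    (.axM (.DisDelta f.2 g.2))

theorem box_himp : box (x ⇨ y) ≤ box x ⇨ box y := by
  obtain ⟨f, rfl⟩ := cls_surjective x
  obtain ⟨g, rfl⟩ := cls_surjective y
  rw [← cls_imp]
  exact le_himp (f := (teamSystem.imp f g).box) (g := f.box) (h := g.box)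
    (.axM (.DisBox f.2 g.2))

theorem box_top : box ⊤ = ⊤ :=
  cls_eq_top_iff.2 (.necBox (teamSystem.imp _ _).2 (thm_imp_self (H := teamSystem) teamSystem.base))

theorem box_compl : box xᶜ = (box x)ᶜ := by
  obtain ⟨f, rfl⟩ := cls_surjective x
  exact team_eq_iff (f := (teamSystem.neg f).box) (g := teamSystem.neg f.box).2
    (.axM (.LinBox f.2))

theorem dia_tensor : (delta (limp x yᶜ))ᶜ = (limp (delta xᶜ)ᶜ (delta yᶜ))ᶜ := by
  obtain ⟨f, rfl⟩ := cls_surjective x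
  obtain ⟨g, rfl⟩ := cls_surjective y
  have h := (team_eq_iff (f := teamSystem.neg (teamSystem.neg (teamSystem.neg
    (f.limp (teamSystem.neg g)))).delta) (g := teamSystem.neg ((teamSystem.neg
    (teamSystem.neg f).delta).limp (teamSystem.neg (teamSystem.neg
    (teamSystem.neg g).delta))))).2 (.axM (.DDiaTensor f.2 g.2))
  simpa only [cls_neg, cls_limp, cls_delta, compl_compl] using h

end Team

theorem flat_le_iff {a b : FlatFormula} :
    flatSystem.cls a ≤ flatSystem.cls b ↔ Derives ∅ (imp a b) := cls_le_cls_iff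

theorem cls_flatIncl_mono {a b : FlatFormula} (h : flatSystem.cls a ≤ flatSystem.cls b) :
    teamSystem.cls (flatIncl a) ≤ teamSystem.cls (flatIncl b) :=
  team_le_iff.2 (.mpMimp (ML_subset_MTL (flatSystem.imp a b).2)
    (teamSystem.imp (flatIncl a) (flatIncl b)).2 (flat_le_iff.1 h) (.axL (.L4 a.2 b.2)))

theorem cls_flat_box_mono {a b : FlatFormula} (h : flatSystem.cls a ≤ flatSystem.cls b) :
    flatSystem.cls (FlatFormula.box a) ≤ flatSystem.cls (FlatFormula.box b) :=
  flat_le_iff.2 (.mpImp (FlatFormula.box (flatSystem.imp a b)).2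
    (flatSystem.imp (FlatFormula.box a) (FlatFormula.box b)).2
    (.necML (flatSystem.imp a b).2 (flat_le_iff.1 h)) (.axH (.K a.2 b.2)))

namespace Flat

/-- The embedding of the algebra of classical formulas. -/
def toTeam : Flat → Team :=
  Quotient.map flatIncl fun _ _ h => setoid_of_cls_eq
    (le_antisymm (cls_flatIncl_mono (cls_sound h).le)
      (cls_flatIncl_mono (cls_sound h).ge))

/-- `□` on the algebra of classical formulas. -/
def box : Flat → Flat :=
  Quotient.map FlatFormula.box fun _ _ h => setoid_of_cls_eq
    (le_antisymm (cls_flat_box_mono (cls_sound h).le)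
      (cls_flat_box_mono (cls_sound h).ge))

variable (a b : Flat)

theorem toTeam_top : toTeam ⊤ = ⊤ :=
  cls_eq_top_iff.2 (thm_imp_self (H := flatSystem) flatSystem.base)

theorem toTeam_himp : toTeam (a ⇨ b) ≤ toTeam a ⇨ toTeam b := by
  obtain ⟨a, rfl⟩ := cls_surjective a
  obtain ⟨b, rfl⟩ := cls_surjective b
  rw [← cls_imp]
  exact Team.le_himp (f := flatIncl (flatSystem.imp a b)) (g := flatIncl a) (h := flatIncl b)
    (.axL (.L4 a.2 b.2))

theorem toTeam_sup : toTeam (a ⊔ b) = (Team.limp (toTeam a) (toTeam b)ᶜ)ᶜ := by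
  obtain ⟨a, rfl⟩ := cls_surjective a
  obtain ⟨b, rfl⟩ := cls_surjective b
  exact ((team_eq_iff (f := teamSystem.neg ((flatIncl a).limp (teamSystem.neg (flatIncl b))))
    (g := flatIncl (flatSystem.imp (flatSystem.neg a) b))).2 (.axS (.FTensor a.2 b.2))).symm

theorem toTeam_le_limp (x : Team) : toTeam a ≤ Team.limp x (toTeam a) := by
  obtain ⟨a, rfl⟩ := cls_surjective a
  obtain ⟨f, rfl⟩ := cls_surjective x
  exact team_le_iff (f := flatIncl a) (g := f.limp (flatIncl a)).2 (.axS (.FLimp a.2 f.2))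

theorem box_toTeam : Team.box (toTeam a) = toTeam (box a) := by
  obtain ⟨a, rfl⟩ := cls_surjective a
  -- The two algebras share the single symbol □.
  rfl

theorem box_top : box ⊤ = ⊤ :=
  cls_eq_top_iff.2 (.necML (flatSystem.imp _ _).2 (thm_imp_self (H := flatSystem) flatSystem.base))

theorem dia_toTeam : (Team.delta (toTeam a)ᶜ)ᶜ = toTeam (box aᶜ)ᶜ := by
  obtain ⟨a, rfl⟩ := cls_surjective a
  exact team_eq_iff (f := teamSystem.neg (teamSystem.neg (flatIncl a)).delta)
    (g := flatIncl (flatSystem.neg (FlatFormula.box (flatSystem.neg a)))).2 (.axM (.FDia a.2))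

theorem toTeam_box_le : toTeam (box a) ≤ Team.delta (toTeam a) := by
  obtain ⟨a, rfl⟩ := cls_surjective a
  exact team_le_iff (f := flatIncl (FlatFormula.box a)) (g := (flatIncl a).delta).2 (.axM (.EBox a.2))

end Flat

/-- Necessitation and distribution over implication make an operator preserve meets; applied to ⊸, Δ
and □, it yields the join laws of ⊗, ◇ and □. -/
theorem map_inf_of_map_himp {B : Type} [BooleanAlgebra B] {φ : B → B} (htop : φ ⊤ = ⊤)
    (himp : ∀ x y, φ (x ⇨ y) ≤ φ x ⇨ φ y) (x y : B) : φ (x ⊓ y) = φ x ⊓ φ y := by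
  have mono {x y : B} (h : x ≤ y) : φ x ≤ φ y := by
    have := himp x y
    rwa [himp_eq_top_iff.2 h, htop, top_le_iff, himp_eq_top_iff] at this
  refine le_antisymm (le_inf (mono inf_le_left) (mono inf_le_right)) ?_
  rw [inf_comm, ← le_himp_iff]
  exact (mono (by rw [le_himp_iff, inf_comm])).trans (himp x (x ⊓ y))

/-- The algebra of formulas of modal team logic. -/
def formulaAlgebra : TeamAlgebra Flat Team where
  e := Flat.toTeam
  tensor x y := (Team.limp x yᶜ)ᶜ
  box := Team.box
  dia x := (Team.delta xᶜ)ᶜ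
  boxM := Flat.box
  e_top := Flat.toTeam_top
  e_himp := Flat.toTeam_himp
  e_sup := Flat.toTeam_sup
  tensor_bot x := by rw [compl_bot, Team.limp_top, compl_top]
  tensor_sup x y z := by
    rw [compl_sup, map_inf_of_map_himp (Team.limp_top x) (Team.limp_himp x), compl_inf]
  tensor_comm x y := by rw [Team.limp_compl_comm]
  tensor_left_comm x y z := by rw [compl_compl, compl_compl, Team.limp_left_comm]
  tensor_flat a x := by
    rw [compl_compl, ← disjoint_iff, disjoint_compl_right_iff]
    exact Flat.toTeam_le_limp a x
  tensor_lax x y z := by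
    have := Team.limp_lax x yᶜ z
    rw [le_himp_iff, ← disjoint_compl_right_iff, disjoint_iff] at this
    rw [le_compl_iff_disjoint_right, disjoint_iff, inf_right_comm, this]
  box_compl := Team.box_compl
  box_sup x y := by
    rw [← compl_compl (x ⊔ y), compl_sup, Team.box_compl,
      map_inf_of_map_himp Team.box_top Team.box_himp, Team.box_compl, Team.box_compl,
      compl_inf, compl_compl, compl_compl]
  box_e := Flat.box_toTeam
  boxM_top := Flat.box_top
  dia_bot := by rw [compl_bot, Team.delta_top, compl_top]
  dia_sup x y := by
    rw [compl_sup, map_inf_of_map_himp Team.delta_top Team.delta_himp, compl_inf]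
  dia_tensor x y := by
    rw [compl_compl, compl_compl, Team.dia_tensor]
  dia_e := Flat.dia_toTeam
  box_flat a := by
    rw [compl_compl, ← disjoint_iff, disjoint_compl_right_iff]
    exact Flat.toTeam_box_le a

/-! ### Normal forms of formulas and their translation into S⁺ -/

theorem isNormal_cls {f : Formula} (hf : f ∈ MTL) :
    formulaAlgebra.IsNormal (teamSystem.cls ⟨f, hf⟩) := by
  induction hf with
  | base ha => exact .e (flatSystem.cls ⟨_, ha⟩)
  | snot _ ih => exact ih.compl
  | mimp hf hg ih₁ ih₂ =>
    have h := cls_imp (H := teamSystem) (p := ⟨_, hf⟩) (q := ⟨_, hg⟩)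
    rw [himp_eq] at h
    exact h ▸ ih₂.sup ih₁.compl
  | @limp f g hf hg ih₁ ih₂ =>
    -- ⊸ is recovered as the dual of ⊗, up to double complements; Δ is likewise the dual of ◇.
    have h := (ih₁.tensor ih₂.compl).compl
    change formulaAlgebra.IsNormal (Team.limp _ _ᶜᶜ)ᶜᶜ at h
    rw [compl_compl, compl_compl] at h
    exact h
  | box _ ih => exact ih.box
  | delta _ ih =>
    have h := ih.compl.dia.compl
    change formulaAlgebra.IsNormal (Team.delta _ᶜᶜ)ᶜᶜ at h
    rw [compl_compl, compl_compl] at h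
    exact h

/-- The classes of the formulas in `S⁺(ML ∪ {NE})`. -/
def splusClasses : Set Team :=
  {x | ∃ f : TeamFormula, (f : Formula) ∈ SPlus (ML ∪ {NE}) ∧ teamSystem.cls f = x}

theorem toTeam_mem_splusClasses (a : Flat) : a.toTeam ∈ splusClasses := by
  obtain ⟨a, rfl⟩ := cls_surjective a
  exact ⟨flatIncl a, .base (.inl a.2), rfl⟩

theorem inf_mem_splusClasses {x y : Team} (hx : x ∈ splusClasses) (hy : y ∈ splusClasses) :
    x ⊓ y ∈ splusClasses := by
  obtain ⟨f, hf, rfl⟩ := hx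
  obtain ⟨g, hg, rfl⟩ := hy
  exact ⟨⟨sand f g, .snot (.mimp f.2 (.snot g.2))⟩, .sand hf hg, rfl⟩

theorem sup_mem_splusClasses {x y : Team} (hx : x ∈ splusClasses) (hy : y ∈ splusClasses) :
    x ⊔ y ∈ splusClasses := by
  obtain ⟨f, hf, rfl⟩ := hx
  obtain ⟨g, hg, rfl⟩ := hy
  exact ⟨⟨sor f g, .mimp (.snot f.2) g.2⟩, .sor hf hg, rfl⟩

theorem tensor_mem_splusClasses {x y : Team} (hx : x ∈ splusClasses) (hy : y ∈ splusClasses) :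
    formulaAlgebra.tensor x y ∈ splusClasses := by
  obtain ⟨f, hf, rfl⟩ := hx
  obtain ⟨g, hg, rfl⟩ := hy
  exact ⟨⟨tensor f g, .snot (.limp f.2 (.snot g.2))⟩, .tensor hf hg, rfl⟩

/-- This is where `NE` enters: strong negation of a flat property is rewritten as the existence of a
nonempty subteam satisfying its classical negation. -/
theorem compl_toTeam_mem_splusClasses (a : Flat) : a.toTeamᶜ ∈ splusClasses := by
  have h := formulaAlgebra.tensor_witness aᶜ
  rw [compl_compl] at h
  change _ = a.toTeamᶜ at h
  rw [← h]
  refine tensor_mem_splusClasses ?_ (inf_mem_splusClasses ?_ (toTeam_mem_splusClasses _))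
  · rw [← Flat.toTeam_top]
    exact toTeam_mem_splusClasses _
  · exact ⟨⟨NE, .snot (.base (.neg (.imp (.atom 0) (.atom 0))))⟩, .base (.inr rfl), rfl⟩

theorem TeamAlgebra.IsNormal.mem_splusClasses {x : Team} (hx : formulaAlgebra.IsNormal x) :
    x ∈ splusClasses := by
  induction hx with
  | term hx =>
    induction hx with
    | flat => exact toTeam_mem_splusClasses _
    | cut b _ ih => exact inf_mem_splusClasses ih (compl_toTeam_mem_splusClasses b)
  | sup _ _ ih₁ ih₂ => exact sup_mem_splusClasses ih₁ ih₂

theorem provEquiv_of_cls_eq {f g : TeamFormula} (h : teamSystem.cls f = teamSystem.cls g) :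
    ProvEquiv f g :=
  ⟨.mpMimp f.2 g.2 (.premise rfl) ((team_le_iff.1 h.le).mono (Set.empty_subset _)),
    .mpMimp g.2 f.2 (.premise rfl) ((team_le_iff.1 h.ge).mono (Set.empty_subset _))⟩

end TeamLogic

theorem mainTheorem11 (φ : TeamLogic.Formula) (hφ : φ ∈ TeamLogic.MTL) :
    ∃ ψ : TeamLogic.Formula,
      ψ ∈ TeamLogic.SPlus (TeamLogic.ML ∪ {TeamLogic.Formula.NE}) ∧
        TeamLogic.ProvEquiv φ ψ := by
  obtain ⟨ψ, hψ, h⟩ := (TeamLogic.isNormal_cls hφ).mem_splusClasses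
  exact ⟨ψ, hψ, TeamLogic.provEquiv_of_cls_eq (f := ⟨φ, hφ⟩) h.symm⟩
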